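/- Let $q\ge 2$ and $s\ge 1$ be integers, with $s$ odd and $q^s$ a power of a prime, and let $G$ be a finite abelian group of order $(q^s+1)(q^{2s}+1)$. Suppose that $G$ contains a difference set with the classical parameters $$(v,k,\lambda)=\left(\frac{Q^4-1}{Q-1},\ \frac{Q^3-1}{Q-1},\ \frac{Q^2-1}{Q-1}\right),\qquad Q=q^s,$$ that is, a $k$-element subset $D\subseteq G$ such that $DD^{(-1)}=\lambda G+(k-\lambda)1$ in the integral group ring $\mathbb{Z}G$, where a subset of $G$ is identified with the sum of its elements and $D^{(-1)}=\sum_{d\in D}d^{-1}$. Let $M$ be any subgroup of $G$ of order $(q+1)(q^2+1)$. Then $\tau\colon x\mapsto x^{q^4}$ is an automorphism of $G$, and $M\le G^{\tau}$, where $G^{\tau}=\{x\in G:\tau(x)=x\}$ is the subgroup of fixed points of $\tau$. Furthermore, if for every prime number $r$ dividing $\gcd(q+1,s)$ or $\gcd(q^2+1,s)$ the Sylow $r$-subgroup of $G$ is cyclic, then $M=G^{\tau}$. -/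

import Mathlib

/-- The element `∑_{d ∈ D} d` of the integral group ring `ℤG` that belongs to a subset `D` of
the group `G`. -/
noncomputable def groupRingElt {G : Type*} [CommGroup G] (D : Finset G) : MonoidAlgebra ℤ G :=
  ∑ d ∈ D, MonoidAlgebra.of ℤ G d

/-- The operation `a = ∑ a_g g ↦ a^(-1) = ∑ a_g g⁻¹` on the integral group ring `ℤG`. -/
noncomputable def groupRingInv {G : Type*} [CommGroup G] (a : MonoidAlgebra ℤ G) :
    MonoidAlgebra ℤ G :=
  MonoidAlgebra.mapDomain (fun g : G => g⁻¹) a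

/-- A `k`-subset `D` (with `k ≥ 1`) of an abelian group `G` of order `v` is a
`(v, k, l)`-difference set in `G` if `D D^(-1) = l G + (k - l) 1` in `ℤG`. -/
structure IsDifferenceSet {G : Type*} [CommGroup G] [Fintype G] (D : Finset G) (v k l : ℕ) :
    Prop where
  card_group : Nat.card G = v
  card_set : D.card = k
  one_le : 1 ≤ k
  mul_inv_eq : groupRingElt D * groupRingInv (groupRingElt D) =
    (l : ℤ) • groupRingElt (Finset.univ : Finset G) + ((k : ℤ) - (l : ℤ)) • 1

/-- `D` is a difference set with the classical parameters
`((Q^d-1)/(Q-1), (Q^(d-1)-1)/(Q-1), (Q^(d-2)-1)/(Q-1))`, where `Q` is a power of a prime.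
All these divisions are exact. -/
def HasClassicalParameters {G : Type*} [CommGroup G] [Fintype G] (D : Finset G) (Q d : ℕ) :
    Prop :=
  IsPrimePow Q ∧ 2 ≤ d ∧
    IsDifferenceSet D ((Q ^ d - 1) / (Q - 1)) ((Q ^ (d - 1) - 1) / (Q - 1))
      ((Q ^ (d - 2) - 1) / (Q - 1))

/-- The subgroup `G^τ` of fixed points of an automorphism `τ` of `G`. -/
def fixedSubgroup {G : Type*} [CommGroup G] (τ : MulAut G) : Subgroup G where
  carrier := {x | τ x = x}
  one_mem' := map_one τ
  mul_mem' {a b} (ha : τ a = a) (hb : τ b = b) := show τ (a * b) = a * b by rw [map_mul, ha, hb]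
  inv_mem' {a} (ha : τ a = a) := show τ a⁻¹ = a⁻¹ by rw [map_inv, ha]

/-! The fixed points of `τ` are the elements killed by `q ^ 4 - 1 = (q - 1) * ((q + 1) * (q ^ 2 +
1))`, so Lagrange puts `M` among them. Equality follows once the order of the fixed subgroup divides
that of `M`, checked one prime `r` at a time in `card_dvd_of_forall_pow_eq_one`. If `r ∤ s`, passing
from `|M|` to `|G|` adds no factor `r`; if `r ∣ s`, cyclic Sylow subgroups turn the bound on the
exponent into one on the order. -/

theorem Nat.Prime.exists_pow_add_one_eq_mul {r a s : ℕ} (hr : r.Prime) (hs : Odd s)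
    (hrs : ¬ r ∣ s) (h : r ∣ a ^ s + 1 → r ∣ a + 1) :
    ∃ c : ℕ, a ^ s + 1 = (a + 1) * c ∧ ¬ r ∣ c := by
  obtain ⟨c, hc⟩ : a + 1 ∣ a ^ s + 1 := by simpa using hs.nat_add_dvd_pow_add_pow a 1
  refine ⟨c, hc, fun hrc => hrs ?_⟩
  have ha : r ∣ a + 1 := h (hc ▸ hrc.mul_left _)
  -- Since `-a ≡ 1` mod `r`, each of the `s` terms is `1`, so `c ≡ s`.
  have hsum : (c : ℤ) = ∑ i ∈ Finset.range s, (-(a : ℤ)) ^ i := by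
    have h1 := geom_sum_mul (-(a : ℤ)) s
    rw [hs.neg_pow] at h1
    have h2 : (a : ℤ) ^ s + 1 = (a + 1) * c := by exact_mod_cast hc
    have h3 : ((a : ℤ) + 1) ≠ 0 := by positivity
    apply mul_left_cancel₀ h3
    linarith
  have := Fact.mk hr
  have haz : -(a : ZMod r) = 1 := by
    have : ((a + 1 : ℕ) : ZMod r) = 0 := (ZMod.natCast_eq_zero_iff _ _).2 ha
    push_cast at this
    linear_combination -this
  have hcz : ((c : ℤ) : ZMod r) = s := by
    rw [hsum]
    push_cast
    simp [haz]
  rw [← ZMod.natCast_eq_zero_iff, ← hcz]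
  exact_mod_cast (ZMod.natCast_eq_zero_iff c r).2 hrc

/-- For odd `s`, `q ^ s` is `q` or `q⁻¹` mod `r`, and `q⁻¹ = -1` forces `q = -1`. -/
theorem dvd_add_one_of_dvd_pow_add_one {r q s : ℕ} (hs : Odd s)
    (h4 : (q : ZMod r) ^ 4 = 1) (h : r ∣ q ^ s + 1) : r ∣ q + 1 := by
  rw [← ZMod.natCast_eq_zero_iff] at h ⊢
  push_cast at h ⊢
  obtain ⟨k, rfl⟩ := hs
  obtain ⟨j, rfl | rfl⟩ := k.even_or_odd'
  · rw [show 2 * (2 * j) + 1 = 4 * j + 1 by ring, pow_succ, pow_mul, h4, one_pow, one_mul] at h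
    exact h
  · rw [show 2 * (2 * j + 1) + 1 = 4 * j + 3 by ring, pow_add, pow_mul, h4, one_pow, one_mul] at h
    linear_combination q * h - h4

theorem dvd_sq_add_one_of_dvd_pow_add_one {r q s : ℕ} (hs : Odd s)
    (h4 : (q : ZMod r) ^ 4 = 1) (h : r ∣ (q ^ 2) ^ s + 1) : r ∣ q ^ 2 + 1 := by
  rw [← ZMod.natCast_eq_zero_iff] at h ⊢
  push_cast at h ⊢
  obtain ⟨k, rfl⟩ := hs
  rw [← pow_mul, show 2 * (2 * k + 1) = 4 * k + 2 by ring, pow_add, pow_mul, h4, one_pow,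
    one_mul] at h
  exact h

theorem sub_one_mul_add_one_mul_sq_add_one {q : ℕ} (hq : 1 ≤ q) :
    q ^ 4 - 1 = (q - 1) * ((q + 1) * (q ^ 2 + 1)) := by
  obtain ⟨n, rfl⟩ := Nat.exists_eq_add_of_le' hq
  rw [Nat.add_sub_cancel]
  apply Nat.sub_eq_of_eq_add
  ring

theorem pow_dvd_of_pow_dvd_mul_of_not_dvd {r s q n : ℕ} (hr : r.Prime) (hs : Odd s)
    (hrs : ¬ r ∣ s) (h4 : (q : ZMod r) ^ 4 = 1)
    (h : r ^ n ∣ (q ^ s + 1) * (q ^ (2 * s) + 1)) : r ^ n ∣ (q + 1) * (q ^ 2 + 1) := by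
  obtain ⟨c, hc, hrc⟩ := hr.exists_pow_add_one_eq_mul hs hrs
    (dvd_add_one_of_dvd_pow_add_one hs h4)
  obtain ⟨d, hd, hrd⟩ := hr.exists_pow_add_one_eq_mul hs hrs
    (dvd_sq_add_one_of_dvd_pow_add_one hs h4)
  rw [pow_mul, hc, hd, mul_mul_mul_comm] at h
  refine Nat.Coprime.dvd_of_dvd_mul_right (Nat.Coprime.pow_left n ?_) h
  exact Nat.Coprime.mul_right ((hr.coprime_iff_not_dvd).2 hrc) ((hr.coprime_iff_not_dvd).2 hrd)

/-- If the Sylow `r`-subgroups of a finite group are cyclic, then every power of `r` that divides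
the order of a subgroup is the order of an element of that subgroup. -/
theorem Subgroup.exists_orderOf_eq_prime_pow {G : Type*} [Group G] [Finite G] {r n : ℕ}
    (hr : r.Prime) (hP : ∀ P : Sylow r G, IsCyclic P) {H : Subgroup G}
    (h : r ^ n ∣ Nat.card H) : ∃ x ∈ H, orderOf x = r ^ n := by
  have := Fact.mk hr
  obtain ⟨K, hK⟩ := Sylow.exists_subgroup_card_pow_prime r h
  have hK' : Nat.card (K.map H.subtype) = r ^ n := by
    rw [← hK]
    exact (Nat.card_congr (K.equivMapOfInjective _ H.subtype_injective).toEquiv).symm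
  obtain ⟨P, hKP⟩ := (IsPGroup.of_card hK').exists_le_sylow
  have := hP P
  have : IsCyclic (K.map H.subtype) :=
    isCyclic_of_injective (Subgroup.inclusion hKP) (Subgroup.inclusion_injective hKP)
  obtain ⟨x, hx⟩ := IsCyclic.exists_ofOrder_eq_natCard (α := K.map H.subtype)
  refine ⟨x, ?_, by rw [Subgroup.orderOf_coe, hx, hK']⟩
  obtain ⟨y, -, hy⟩ := x.2
  exact hy ▸ y.2

theorem card_dvd_of_forall_pow_eq_one {G : Type*} [CommGroup G] [Finite G] {q s : ℕ}
    (hq : 1 ≤ q) (hs : Odd s) (hG : Nat.card G = (q ^ s + 1) * (q ^ (2 * s) + 1))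
    {H : Subgroup G} (hH : ∀ x ∈ H, x ^ (q ^ 4 - 1) = 1)
    (hcyc : ∀ r : ℕ, r.Prime → (r ∣ Nat.gcd (q + 1) s ∨ r ∣ Nat.gcd (q ^ 2 + 1) s) →
      ∀ P : Sylow r G, IsCyclic P) :
    Nat.card H ∣ (q + 1) * (q ^ 2 + 1) := by
  rw [Nat.dvd_iff_prime_pow_dvd_dvd]
  intro r n hr hn
  rcases Nat.eq_zero_or_pos n with rfl | hn0
  · simp
  have := Fact.mk hr
  have hrH : r ∣ Nat.card H := (dvd_pow_self r hn0.ne').trans hn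
  have hr4 : r ∣ q ^ 4 - 1 := by
    obtain ⟨x, hx⟩ := exists_prime_orderOf_dvd_card' r hrH
    rw [← hx, ← Subgroup.orderOf_coe]
    exact orderOf_dvd_of_pow_eq_one (hH x x.2)
  have h4 : (q : ZMod r) ^ 4 = 1 := by
    rw [← ZMod.natCast_eq_zero_iff, Nat.cast_sub (Nat.one_le_pow _ _ hq)] at hr4
    push_cast at hr4
    exact sub_eq_zero.1 hr4
  have hHG : Nat.card H ∣ (q ^ s + 1) * (q ^ (2 * s) + 1) := hG ▸ H.card_subgroup_dvd_card
  by_cases hrs : r ∣ s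
  · have hdvd : r ∣ q + 1 ∨ r ∣ q ^ 2 + 1 := by
      refine (hr.dvd_mul.1 (hrH.trans hHG)).imp (dvd_add_one_of_dvd_pow_add_one hs h4) fun h => ?_
      rw [pow_mul] at h
      exact dvd_sq_add_one_of_dvd_pow_add_one hs h4 h
    have hP := hcyc r hr (hdvd.imp (Nat.dvd_gcd · hrs) (Nat.dvd_gcd · hrs))
    obtain ⟨x, hxH, hx⟩ := Subgroup.exists_orderOf_eq_prime_pow hr hP hn
    -- It remains to discard the factor `q - 1`: if `r ∣ q - 1`, then `q + 1` and `q ^ 2 + 1` are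
    -- both `2` mod `r`, but `r` is odd as a divisor of `s`.
    have hdiv : r ^ n ∣ q ^ 4 - 1 := hx ▸ orderOf_dvd_of_pow_eq_one (hH x hxH)
    rw [sub_one_mul_add_one_mul_sq_add_one hq] at hdiv
    refine Nat.Coprime.dvd_of_dvd_mul_left (Nat.Coprime.pow_left n ?_) hdiv
    rw [hr.coprime_iff_not_dvd]
    intro hr1
    have hr2 : ¬ r ∣ 2 := fun h2 => by
      rw [(Nat.prime_dvd_prime_iff_eq hr Nat.prime_two).1 h2] at hrs
      exact hs.not_two_dvd_nat hrs
    rw [← ZMod.natCast_eq_zero_iff] at hr1 hr2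
    rw [Nat.cast_sub hq] at hr1
    simp_rw [← ZMod.natCast_eq_zero_iff] at hdvd
    push_cast at hr1 hr2 hdvd
    rcases hdvd with h | h
    · exact hr2 (by linear_combination h - hr1)
    · exact hr2 (by linear_combination h - (q + 1) * hr1)
  · exact pow_dvd_of_pow_dvd_mul_of_not_dvd hr hs hrs h4 (hn.trans hHG)

theorem lemma4p1 {G : Type*} [CommGroup G] [Fintype G] (q s : ℕ) (hs : Odd s)
    (hG : Nat.card G = (q ^ s + 1) * (q ^ (2 * s) + 1))
    (hD : ∃ D : Finset G, HasClassicalParameters D (q ^ s) 4)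
    (M : Subgroup G) (hM : Nat.card M = (q + 1) * (q ^ 2 + 1)) :
    ∃ τ : MulAut G, (∀ x : G, τ x = x ^ (q ^ 4)) ∧
      M ≤ fixedSubgroup τ ∧
      ((∀ r : ℕ, r.Prime → (r ∣ Nat.gcd (q + 1) s ∨ r ∣ Nat.gcd (q ^ 2 + 1) s) →
          ∀ P : Sylow r G, IsCyclic P) →
        M = fixedSubgroup τ) := by
  have hq : 1 ≤ q := by
    obtain ⟨-, hQ, -⟩ := hD
    rcases Nat.eq_zero_or_pos q with rfl | h
    · rw [zero_pow hs.pos.ne'] at hQ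
      exact absurd hQ not_isPrimePow_zero
    · exact h
  have hqs : Nat.Coprime (q ^ 4) (Nat.card G) := by
    have key : ∀ m, m ≠ 0 → Nat.Coprime q (q ^ m + 1) := fun m hm => by
      obtain ⟨k, rfl⟩ := Nat.exists_eq_succ_of_ne_zero hm
      simp [pow_succ]
    rw [hG]
    exact Nat.Coprime.pow_left 4
      ((key s hs.pos.ne').mul_right (key (2 * s) (by have := hs.pos; omega)))
  have hbij : Function.Bijective (powMonoidHom (q ^ 4) : G →* G) :=
    (powCoprime hqs.symm).bijective
  have hτ : ∀ x, MulEquiv.ofBijective (powMonoidHom (q ^ 4) : G →* G) hbij x = x ^ (q ^ 4) :=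
    fun x => rfl
  have hfix : ∀ x, x ∈ fixedSubgroup (MulEquiv.ofBijective (powMonoidHom (q ^ 4) : G →* G) hbij) ↔
      x ^ (q ^ 4 - 1) = 1 := fun x => by
    change x ^ (q ^ 4) = x ↔ _
    rw [← mul_eq_right (a := x ^ (q ^ 4 - 1)) (b := x), ← pow_succ,
      Nat.sub_add_cancel (Nat.one_le_pow _ _ hq)]
  refine ⟨MulEquiv.ofBijective (powMonoidHom (q ^ 4)) hbij, hτ, ?_⟩
  have hle : M ≤ fixedSubgroup (MulEquiv.ofBijective (powMonoidHom (q ^ 4) : G →* G) hbij) := by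
    intro x hx
    rw [hfix, ← orderOf_dvd_iff_pow_eq_one, sub_one_mul_add_one_mul_sq_add_one hq, ← hM]
    exact (M.orderOf_dvd_natCard hx).mul_left _
  refine ⟨hle, fun hcyc => Subgroup.eq_of_le_of_card_ge hle ?_⟩
  refine Nat.le_of_dvd Nat.card_pos ?_
  rw [hM]
  exact card_dvd_of_forall_pow_eq_one hq hs hG (fun x hx => (hfix x).1 hx) hcyc
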